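/- Let $\Bbbk$ be an algebraically closed field of characteristic zero and let $\mathcal C$ be a pivotal finite tensor category over $\Bbbk$, i.e. a rigid monoidal, finite $\Bbbk$-linear abelian category with $\Bbbk$-bilinear tensor product and $\operatorname{End}(\mathbf 1)\cong\Bbbk$ as algebras, together with a monoidal natural isomorphism $j:\mathrm{id}_{\mathcal C}\to(-)^{**}$. Let $F:\mathcal Z(\mathcal C)\to\mathcal C$ be the forgetful functor from the Drinfeld center, $R$ a right adjoint of $F$ with counit $\epsilon$, $A=R(\mathbf 1)$ the adjoint algebra (an algebra in $\mathcal Z(\mathcal C)$ through the lax monoidal structure of $R$), and $\epsilon_{\mathbf 1}:A\to\mathbf 1$ the value of the counit at $\mathbf 1$. For an object $M$ let $\pi_M:A\to M\otimes M^*$ be the canonical dinatural morphism, i.e. the composite of $\mathrm{id}_A\otimes\mathrm{coev}_M$ with $\big((\mathrm{id}_M\otimes\epsilon_{\mathbf 1})\circ c_{A,M}\big)\otimes\mathrm{id}_{M^*}$, where $c_{A,-}$ is the half braiding of $A$; let $$\alpha_M=(\mathrm{id}_M\otimes \mathrm{ev}_M)\circ(\pi_M\otimes \mathrm{id}_M):A\otimes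 M\to M$$ be the canonical action, let $$\widetilde{\mathrm{ev}}_M=\mathrm{ev}_{M^*}\circ(j_M\otimes\mathrm{id}_{M^*}),\qquad \mathrm{ch}(M)=\widetilde{\mathrm{ev}}_M\circ(\alpha_M\otimes\mathrm{id}_{M^*})\circ(\mathrm{id}_A\otimes\mathrm{coev}_M):A\to\mathbf 1$$ be the right evaluation and the internal character, and let $d(M)\in\Bbbk$ be the right pivotal dimension, $d(M)\,\mathrm{id}_{\mathbf 1}=\widetilde{\mathrm{ev}}_M\circ\mathrm{coev}_M$. Let $\iota: L\hookrightarrow A$ be a unitary subalgebra in $\mathcal Z(\mathcal C)$ (a monomorphism of unital algebras), and put $\underline\epsilon_L=\epsilon_{\mathbf 1}\circ\iota:L\to\mathbf 1$ and $\mathrm{Res}(f)=f\circ\iota$ for $f:A\to\mathbf 1$. Let $\mathcal C_L^{\mathrm{triv}}$ be the full abelian subcategory of $\mathcal C$ of all objects $M$ on which $L$ acts trivially, i.e. $\alpha_M\circ(\iota\otimes\mathrm{id}_M)=\underline\epsilon_L\otimes\mathrm{id}_M$. Let $\mathcal S_L$ be the full abelian subcategory of $\mathcal C$ generated by the simple objects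 $V$ with $\mathrm{Res}(\mathrm{ch}(V))=d(V)\,\underline\epsilon_L$, i.e. consisting of the objects all of whose composition factors are such $V$. Then $$\mathcal C_L^{\mathrm{triv}}\subseteq\mathcal S_L ,$$ and moreover $\mathrm{Res}(\mathrm{ch}(M))=d(M)\,\underline\epsilon_L$ for every object $M$ of $\mathcal C_L^{\mathrm{triv}}$. -/

import Mathlib

open CategoryTheory MonoidalCategory Limits
open scoped MonObj ZeroObject

universe v u w

set_option linter.unusedSectionVars false

noncomputable section

namespace FTC

section Pivotal

variable {C : Type u} [Category.{v} C] [MonoidalCategory C] [RightRigidCategory C]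

/-- The dual object `X*`, with its evaluation `X* ⊗ X ⟶ 𝟙` and coevaluation `𝟙 ⟶ X ⊗ X*`. -/
abbrev dual (X : C) : C := @HasRightDual.rightDual C _ _ X (RightRigidCategory.rightDual X)

/-- `ev_X : X* ⊗ X ⟶ 𝟙`. -/
abbrev ev (X : C) : dual X ⊗ X ⟶ 𝟙_ C := ExactPairing.evaluation X (dual X)

/-- `coev_X : 𝟙 ⟶ X ⊗ X*`. -/
abbrev coev (X : C) : 𝟙_ C ⟶ X ⊗ dual X := ExactPairing.coevaluation X (dual X)

/-- The transpose `f* : Y* ⟶ X*` of `f : X ⟶ Y`. -/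
abbrev dualMap {X Y : C} (f : X ⟶ Y) : dual Y ⟶ dual X :=
  @rightAdjointMate C _ _ X Y (RightRigidCategory.rightDual X) (RightRigidCategory.rightDual Y) f

/-- The canonical isomorphism `(X ⊗ Y)* ≅ Y* ⊗ X*` (uniqueness of duals). -/
def dualTensor (X Y : C) : dual (X ⊗ Y) ≅ dual Y ⊗ dual X :=
  rightDualIso (X := X ⊗ Y) inferInstance ExactPairing.tensor

/-- The canonical isomorphism `𝟙* ≅ 𝟙` (uniqueness of duals). -/
def dualUnit : dual (𝟙_ C) ≅ 𝟙_ C :=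
  rightDualIso (X := 𝟙_ C) (@HasRightDual.exact C _ _ _ (RightRigidCategory.rightDual (𝟙_ C)))
    exactPairingUnit

/-- The monoidal structure morphism `X** ⊗ Y** ⟶ (X ⊗ Y)**` of the functor `(-)**`. -/
def bidualTensor (X Y : C) : dual (dual X) ⊗ dual (dual Y) ⟶ dual (dual (X ⊗ Y)) :=
  (dualTensor (dual Y) (dual X)).inv ≫ dualMap (dualTensor X Y).hom

/-- The monoidal structure morphism `𝟙 ⟶ 𝟙**` of the functor `(-)**`. -/
def bidualUnit : 𝟙_ C ⟶ dual (dual (𝟙_ C)) :=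
  dualUnit.inv ≫ dualMap (dualUnit (C := C)).hom

variable (C) in
/-- A pivotal structure: a monoidal natural isomorphism `j : id ≅ (-)**`. -/
structure PivotalStructure where
  j (X : C) : X ≅ dual (dual X)
  naturality {X Y : C} (f : X ⟶ Y) : f ≫ (j Y).hom = (j X).hom ≫ dualMap (dualMap f)
  unit : (j (𝟙_ C)).hom = bidualUnit
  tensor (X Y : C) :
    (j (X ⊗ Y)).hom = ((j X).hom ⊗ₘ (j Y).hom) ≫ bidualTensor X Y

/-- The right evaluation `X ⊗ X* ⟶ X** ⊗ X* ⟶ 𝟙` of a pivotal structure. -/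
def PivotalStructure.rev (p : PivotalStructure C) (X : C) : X ⊗ dual X ⟶ 𝟙_ C :=
  (p.j X).hom ▷ dual X ≫ ev (dual X)

/-- The right partial pivotal trace `A ⟶ B` of `f : A ⊗ X ⟶ B ⊗ X`. -/
def PivotalStructure.partialTrace (p : PivotalStructure C) {A B : C} (X : C)
    (f : A ⊗ X ⟶ B ⊗ X) : A ⟶ B :=
  (ρ_ A).inv ≫ A ◁ coev X ≫ (α_ A X (dual X)).inv ≫ f ▷ dual X ≫
    (α_ B X (dual X)).hom ≫ B ◁ p.rev X ≫ (ρ_ B).hom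

/-- The right pivotal trace of an endomorphism, as an endomorphism of the unit object. -/
def PivotalStructure.trace (p : PivotalStructure C) {X : C} (f : X ⟶ X) : End (𝟙_ C) :=
  p.partialTrace X (𝟙_ C ◁ f)

end Pivotal

/-- A finite tensor category over `k`: a rigid monoidal, `k`-linear abelian category with
`k`-bilinear tensor product which is finite (finite-dimensional morphism spaces, all objects of
finite length, enough projectives, finitely many simple objects up to isomorphism), and with
`End 𝟙 ≃ k` as `k`-algebras. -/
class IsFiniteTensorCategory (k : Type w) [Field k] (C : Type u) [Category.{v} C] [Abelian C]
    [Linear k C] [MonoidalCategory C] [MonoidalPreadditive C] [MonoidalLinear k C]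
    [RigidCategory C] : Prop where
  finite_hom (X Y : C) : Module.Finite k (X ⟶ Y)
  noetherian (X : C) : IsNoetherianObject X
  artinian (X : C) : IsArtinianObject X
  enoughProjectives : EnoughProjectives C
  finite_simples : ∃ (n : ℕ) (S : Fin n → C), ∀ X : C, Simple X → ∃ i, Nonempty (X ≅ S i)
  end_unit : Nonempty (End (𝟙_ C) ≃ₐ[k] k)

section Dimension

variable (k : Type w) [Field k] {C : Type u} [Category.{v} C] [Abelian C]
    [Linear k C] [MonoidalCategory C] [MonoidalPreadditive C] [MonoidalLinear k C]
    [RigidCategory C] [IsFiniteTensorCategory k C]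

/-- The right pivotal dimension `d(X)`: the scalar corresponding to the trace of `id_X` under the
(unique) isomorphism of `k`-algebras `End 𝟙 ≃ k`. -/
def PivotalStructure.dim (p : PivotalStructure C) (X : C) : k :=
  (IsFiniteTensorCategory.end_unit (k := k) (C := C)).some (p.trace (𝟙 X))

theorem PivotalStructure.dim_smul_id (p : PivotalStructure C) (X : C) :
    p.dim k X • 𝟙 (𝟙_ C) = p.trace (𝟙 X) := by
  set e := (IsFiniteTensorCategory.end_unit (k := k) (C := C)).some with he
  apply e.injective
  have : p.dim k X • 𝟙 (𝟙_ C) = algebraMap k (End (𝟙_ C)) (p.dim k X) := by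
    rw [Algebra.algebraMap_eq_smul_one]; rfl
  rw [this, AlgEquiv.commutes]
  rfl

end Dimension

section AdjointAlgebra

variable {C : Type u} [Category.{v} C] [MonoidalCategory C]
  {R : C ⥤ Center C} (adj : Center.forget C ⊣ R)

/-- The adjoint algebra `A = R(𝟙)` in the Drinfeld center, where `R` is a right adjoint of the
forgetful functor `F : Z(C) ⥤ C`. -/
def adjointAlgebra (_ : Center.forget C ⊣ R) : Center C := R.obj (𝟙_ C)

/-- The algebra structure on `A = R(𝟙)` in `Z(C)`, induced by the algebra `𝟙` and the
lax monoidal structure of `R` as the right adjoint of a monoidal functor. -/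
instance : MonObj (adjointAlgebra adj) :=
  letI := adj.rightAdjointLaxMonoidal
  R.monObjObj (X := 𝟙_ C)

/-- The counit `ε_𝟙 : A ⟶ 𝟙` of the adjunction, a morphism in `C`. -/
def counit : (adjointAlgebra adj).1 ⟶ 𝟙_ C := adj.counit.app (𝟙_ C)

/-- A unitary subalgebra of `A` in `Z(C)`: a monomorphism `incl : L ⟶ A` in `Z(C)` of
unital algebras. -/
structure UnitarySubalgebra where
  L : Center C
  [mon : MonObj L]
  incl : L ⟶ adjointAlgebra adj
  [mono : Mono incl]
  [isMonHom : IsMonHom incl]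

variable [RigidCategory C]

/-- The universal dinatural transformation `π_{𝟙;X} : A ⟶ X ⊗ X*` that exhibits `A` as the end of
`X ⊗ X*`, written through the half braiding and the counit of `A`:
`A ⟶ A ⊗ X ⊗ X* ⟶ X ⊗ A ⊗ X* ⟶ X ⊗ X*`. -/
def proj (X : C) : (adjointAlgebra adj).1 ⟶ X ⊗ dual X :=
  (ρ_ _).inv ≫ (adjointAlgebra adj).1 ◁ coev X ≫ (α_ _ _ _).inv ≫
    (((adjointAlgebra adj).2.β X).hom ≫ X ◁ counit adj ≫ (ρ_ X).hom) ▷ dual X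

/-- The canonical action `α_X : A ⊗ X ⟶ X ⊗ X* ⊗ X ⟶ X` of the adjoint algebra. -/
def action (X : C) : (adjointAlgebra adj).1 ⊗ X ⟶ X :=
  proj adj X ▷ X ≫ (α_ X (dual X) X).hom ≫ X ◁ ev X ≫ (ρ_ X).hom

/-- The internal character `ch(X) : A ⟶ 𝟙`, the partial pivotal trace of the action `α_X`. -/
def character (p : PivotalStructure C) (X : C) : (adjointAlgebra adj).1 ⟶ 𝟙_ C :=
  p.partialTrace X (action adj X ≫ (λ_ X).inv)

/-- The action can be written as `A ⊗ X ⟶ X ⊗ A ⟶ X` with the half braiding and the counit. -/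
theorem action_eq (X : C) :
    action adj X =
      ((adjointAlgebra adj).2.β X).hom ≫ X ◁ counit adj ≫ (ρ_ X).hom := by
  unfold action proj
  generalize ((adjointAlgebra adj).2.β X).hom ≫ X ◁ counit adj ≫ (ρ_ X).hom = g
  generalize (adjointAlgebra adj).1 = A at g
  calc
    _ = 𝟙 _ ⊗≫ A ◁ coev X ▷ X ⊗≫ (g ▷ (dual X ⊗ X) ≫ X ◁ ev X) ⊗≫ 𝟙 _ := by monoidal
    _ = 𝟙 _ ⊗≫ A ◁ coev X ▷ X ⊗≫ ((A ⊗ X) ◁ ev X ≫ g ▷ 𝟙_ C) ⊗≫ 𝟙 _ := by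
      rw [whisker_exchange]
    _ = 𝟙 _ ⊗≫ A ◁ (coev X ▷ X ⊗≫ X ◁ ev X) ⊗≫ g := by monoidal
    _ = g := by rw [ExactPairing.evaluation_coevaluation'']; monoidal

/-- The action is natural in the object. -/
theorem action_naturality {X Y : C} (f : X ⟶ Y) :
    action adj X ≫ f = (adjointAlgebra adj).1 ◁ f ≫ action adj Y := by
  simp only [action_eq, Category.assoc, HalfBraiding.naturality_assoc]
  rw [← whisker_exchange_assoc]
  simp

end AdjointAlgebra

section Subcategories

variable {C : Type u} [Category.{v} C] [Abelian C] [MonoidalCategory C] [RigidCategory C]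
  {R : C ⥤ Center C} {adj : Center.forget C ⊣ R}

namespace UnitarySubalgebra

/-- Restriction of class functions along `L ⟶ A`: `Res : Hom_C(A, 𝟙) ⟶ Hom_C(L, 𝟙)`. -/
def res (S : UnitarySubalgebra adj) (f : (adjointAlgebra adj).1 ⟶ 𝟙_ C) : S.L.1 ⟶ 𝟙_ C :=
  S.incl.f ≫ f

/-- The restriction of `ε_𝟙 : A ⟶ 𝟙` to `L`. -/
def counitRes (S : UnitarySubalgebra adj) : S.L.1 ⟶ 𝟙_ C := S.res (counit adj)

/-- The restriction of the action `α_M` to `L`. -/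
def actionRes (S : UnitarySubalgebra adj) (M : C) : S.L.1 ⊗ M ⟶ M :=
  S.incl.f ▷ M ≫ action adj M

/-- The full subcategory of the objects `M` on which `L` acts trivially: the restriction of
`α_M` to `L ⊗ M` is the restricted counit tensored with `id_M`. -/
def triv (S : UnitarySubalgebra adj) : ObjectProperty C := fun M =>
  S.actionRes M = S.counitRes ▷ M ≫ (λ_ M).hom

theorem actionRes_naturality (S : UnitarySubalgebra adj) {M N : C} (f : M ⟶ N) :
    S.actionRes M ≫ f = S.L.1 ◁ f ≫ S.actionRes N := by
  simp only [actionRes, Category.assoc, action_naturality]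
  rw [whisker_exchange_assoc]

theorem trivial_naturality (S : UnitarySubalgebra adj) {M N : C} (f : M ⟶ N) :
    (S.counitRes ▷ M ≫ (λ_ M).hom) ≫ f =
      S.L.1 ◁ f ≫ S.counitRes ▷ N ≫ (λ_ N).hom := by
  rw [whisker_exchange_assoc]
  simp

instance (S : UnitarySubalgebra adj) : S.triv.IsClosedUnderSubobjects where
  prop_of_mono {M N} f _ hN := by
    unfold triv at hN ⊢
    rw [← cancel_mono f, actionRes_naturality, trivial_naturality, hN]

instance (S : UnitarySubalgebra adj) : S.triv.IsClosedUnderQuotients where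
  prop_of_epi {M N} f _ hM := by
    have : (tensorLeft S.L.1).IsLeftAdjoint :=
      (tensorLeftAdjunction (ᘁS.L.1 : C) S.L.1).isLeftAdjoint
    have : Epi (S.L.1 ◁ f) := inferInstanceAs (Epi ((tensorLeft S.L.1).map f))
    unfold triv at hM ⊢
    rw [← cancel_epi (S.L.1 ◁ f), ← actionRes_naturality, ← trivial_naturality, hM]

instance (S : UnitarySubalgebra adj) (J : Type*) [Category* J] :
    S.triv.IsClosedUnderLimitsOfShape J where
  limitsOfShape_le := by
    rintro M ⟨p⟩
    refine p.isLimit.hom_ext fun j => ?_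
    have := p.prop_diag_obj j
    unfold triv at this
    exact (S.actionRes_naturality _).trans
      ((congrArg _ this).trans (S.trivial_naturality _).symm)

instance (S : UnitarySubalgebra adj) : S.triv.ContainsZero where
  exists_zero := ⟨0, isZero_zero C, by
    unfold triv
    exact (isZero_zero C).eq_of_tgt _ _⟩

/-- Together with the previous instances: `C_L^triv` is a full abelian subcategory of `C`. -/
instance (S : UnitarySubalgebra adj) : S.triv.IsClosedUnderFiniteProducts where

end UnitarySubalgebra

/-- `V` is a subquotient of `M`, i.e. a quotient of a subobject of `M`. -/
def IsSubquotient (V M : C) : Prop :=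
  ∃ (N : C) (i : N ⟶ M) (q : N ⟶ V), Mono i ∧ Epi q

namespace UnitarySubalgebra

variable (k : Type w) [Field k] [Linear k C] [MonoidalPreadditive C] [MonoidalLinear k C]
  [IsFiniteTensorCategory k C]

/-- `Res(ch(M)) = d(M) ε_L`: the character of `M` has trivial restriction to `L`. -/
def HasTrivialCharacter (S : UnitarySubalgebra adj) (p : PivotalStructure C) (M : C) : Prop :=
  S.res (character adj p M) = p.dim k M • S.counitRes

/-- The full abelian subcategory `S_L` of `C` generated by the simple objects whose character has
trivial restriction to `L`: the objects all of whose composition factors are such simple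
objects. (For semisimple `C` these are the direct sums of such simple objects.) -/
def charSubcategory (S : UnitarySubalgebra adj) (p : PivotalStructure C) : ObjectProperty C :=
  fun M => ∀ V : C, Simple V → IsSubquotient V M → S.HasTrivialCharacter k p V

/-- `S_L` is a Serre subcategory, in particular an abelian subcategory. -/
instance (S : UnitarySubalgebra adj) (p : PivotalStructure C) :
    (S.charSubcategory k p).IsSerreClass where
  exists_zero := ⟨0, isZero_zero C, by
    rintro V hV ⟨N, i, q, hi, hq⟩
    have hN : IsZero N := (isZero_zero C).of_mono i
    exact absurd (hN.of_epi q) (Simple.not_isZero V)⟩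
  prop_of_mono := by
    rintro X Y f hf hY V hV ⟨N, i, q, hi, hq⟩
    exact hY V hV ⟨N, i ≫ f, q, mono_comp _ _, hq⟩
  prop_of_epi := by
    rintro X Y f hf hX V hV ⟨N, i, q, hi, hq⟩
    exact hX V hV ⟨pullback f i, pullback.fst f i, pullback.snd f i ≫ q,
      inferInstance, epi_comp _ _⟩
  prop_X₂_of_shortExact := by
    rintro T hT h₁ h₃ V hV ⟨N, i, q, hi, hq⟩
    have := hT.mono_f
    have := hT.epi_g
    -- the part of `N` inside `T.X₁`
    let K := pullback T.f i
    let a : K ⟶ N := pullback.snd T.f i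
    by_cases h : a ≫ q = 0
    · -- `q` factors through the image of `N` in `T.X₃`
      have hker : kernel.ι (i ≫ T.g) ≫ q = 0 := by
        have e : (kernel.ι (i ≫ T.g) ≫ i) ≫ T.g = 0 := by
          rw [Category.assoc, kernel.condition]
        have e' := hT.exact.lift_f (kernel.ι (i ≫ T.g) ≫ i) e
        have : kernel.ι (i ≫ T.g) = pullback.lift _ _ e' ≫ a :=
          (pullback.lift_snd _ _ _).symm
        rw [this, Category.assoc, h, comp_zero]
      let r : Abelian.coimage (i ≫ T.g) ⟶ V := cokernel.desc _ q hker
      have hr : cokernel.π (kernel.ι (i ≫ T.g)) ≫ r = q := cokernel.π_desc _ _ _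
      have : Epi r := epi_of_epi_fac hr
      exact h₃ V hV ⟨_, Abelian.factorThruCoimage (i ≫ T.g), r, inferInstance, this⟩
    · have : Epi (a ≫ q) := epi_of_nonzero_to_simple h
      exact h₁ V hV ⟨K, pullback.fst T.f i, a ≫ q, inferInstance, this⟩

end UnitarySubalgebra

end Subcategories

end FTC
end

namespace FTC

section PartialTrace

variable {C : Type u} [Category.{v} C] [MonoidalCategory C] [RightRigidCategory C]

namespace PivotalStructure

/-! The restricted character is the partial pivotal trace over `M` of the action of `L`, because
precomposition with the inclusion of `L` slides through the trace over `M`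
(`partialTrace_naturality_left`). If `L` acts trivially, the traced morphism is `S.counitRes`
whiskered with `M`; its partial trace splits as `S.counitRes` followed by the closed loop on `M`,
which is the scalar d(M). This gives the second claim. Trivial action passes to subquotients, so the
same computation applies to every composition factor, which gives the inclusion. -/

theorem partialTrace_naturality_left (p : PivotalStructure C) {A A' B : C} (X : C)
    (g : A' ⟶ A) (f : A ⊗ X ⟶ B ⊗ X) :
    p.partialTrace X (g ▷ X ≫ f) = g ≫ p.partialTrace X f := by
  simp only [partialTrace, comp_whiskerRight, Category.assoc]
  rw [rightUnitor_inv_naturality_assoc, ← whisker_exchange_assoc,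
    associator_inv_naturality_left_assoc]

/-- The strand of `g` is disjoint from the loop on `X`, so the loop closes up separately. Formally,
this is naturality applied to the identity of `𝟙_ C ⊗ X`. -/
theorem partialTrace_whiskerRight (p : PivotalStructure C) {A : C} (X : C) (g : A ⟶ 𝟙_ C) :
    p.partialTrace X (g ▷ X) = g ≫ p.trace (𝟙 X) := by
  have h := p.partialTrace_naturality_left X g (𝟙_ C ◁ 𝟙 X)
  -- The last rewrite restores the form `𝟙_ C ◁ 𝟙 X` on the right-hand side, which is `p.trace (𝟙
  -- X)` by definition.
  rwa [whiskerLeft_id, Category.comp_id, ← whiskerLeft_id] at h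

end PivotalStructure

end PartialTrace

namespace UnitarySubalgebra

variable {C : Type u} [Category.{v} C] [Abelian C] [MonoidalCategory C] [RigidCategory C]
  {R : C ⥤ Center C} {adj : Center.forget C ⊣ R}

theorem res_character (S : UnitarySubalgebra adj) (p : PivotalStructure C) (M : C) :
    S.res (character adj p M) = p.partialTrace M (S.actionRes M ≫ (λ_ M).inv) := by
  rw [res, character, ← p.partialTrace_naturality_left, actionRes, Category.assoc]

/-- Both closure properties rest on naturality of the two actions being compared: for a subobject
one cancels the mono, for a quotient the epi whiskered with `L`, which stays epi since tensoring
with `L` is a left adjoint. -/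
theorem triv_of_isSubquotient (S : UnitarySubalgebra adj) {V M : C} (hM : S.triv M)
    (h : IsSubquotient V M) : S.triv V := by
  obtain ⟨N, i, q, _, _⟩ := h
  exact S.triv.prop_of_epi q (S.triv.prop_of_mono i hM)

theorem hasTrivialCharacter_of_triv (k : Type w) [Field k] [Linear k C]
    [MonoidalPreadditive C] [MonoidalLinear k C] [IsFiniteTensorCategory k C]
    (S : UnitarySubalgebra adj) (p : PivotalStructure C) {M : C} (hM : S.triv M) :
    S.HasTrivialCharacter k p M := by
  unfold triv at hM
  -- The unitor in the trivial action cancels the one in the character, leaving exactly a whiskered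
  -- morphism under the trace; the loop is then replaced by its scalar.
  rw [HasTrivialCharacter, res_character, hM, Category.assoc, Iso.hom_inv_id,
    Category.comp_id, p.partialTrace_whiskerRight, ← p.dim_smul_id k, Linear.comp_smul,
    Category.comp_id]

end UnitarySubalgebra

end FTC

theorem proposition3p63 {k : Type w} [Field k] [IsAlgClosed k] [CharZero k]
    {C : Type u} [Category.{v} C] [Abelian C] [Linear k C]
    [MonoidalCategory C] [MonoidalPreadditive C] [MonoidalLinear k C] [RigidCategory C]
    [FTC.IsFiniteTensorCategory k C] (p : FTC.PivotalStructure C)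
    {R : C ⥤ Center C} (adj : Center.forget C ⊣ R) (S : FTC.UnitarySubalgebra adj) :
    S.triv ≤ S.charSubcategory k p ∧
      ∀ M : C, S.triv M → S.HasTrivialCharacter k p M :=
  ⟨fun _ hM _ _ hV => S.hasTrivialCharacter_of_triv k p (S.triv_of_isSubquotient hM hV),
    fun _ hM => S.hasTrivialCharacter_of_triv k p hM⟩
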